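/- Let $X\subset\mathbb R^n$, $n\ge 2$, be open and connected, and let $A=\sum_{|\alpha|\le m}a_\alpha(x)\partial^\alpha$ be a $(k\times k)$-matrix linear differential operator of order $m\ge 1$ ($k\ge1$) with real $C^\infty(X)$ coefficients, elliptic on $X$ (i.e. $\sum_{|\alpha|=m}a_\alpha(x)(\mathrm i\zeta)^\alpha$ is invertible for all $x\in X$, $\zeta\in\mathbb R^n\setminus\{0\}$), such that both $A$ and its formal adjoint $A^*$ have the unique continuation property on $X$: on every domain $U\subset X$, a distributional solution vanishing on a non-empty open subset of $U$ is zero. Let $D$ be a domain, relatively compact in $X$, with $\partial D\in C^\infty$, such that $X\setminus D$ has no compact components. Let $s\in\mathbb Z$, $1<p<\infty$, and let $S_A^{s,p}(D)$ be the Banach space of all $u\in[W^{s,p}(D)]^k$ with $Au=0$ in $D$ in the sense of distributions, with the norm of $[W^{s,p}(D)]^k$; here, for $s\ge0$, $\|u\|_{W^{s,p}(D)}=\big(\sum_{|\alpha|\le s}\|\partial^\alpha u\|^p_{L^p(D)}\big)^{1/p}$, for $s<0$ the space $W^{s,p}(D)$ is the dual of $W_0^{-s,p'}(D)$, $1/p+1/p'=1$,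 with the dual norm, and $\|u\|_{[W^{s,p}(D)]^k}=\big(\sum_{j=1}^k\|u_j\|_{W^{s,p}(D)}^p\big)^{1/p}$. Let $\{v^{(j,r)}\}_{j\in\mathbb N,\,1\le r\le k}$ be a linearly independent system in the dual $(S_A^{s,p}(D))^*$ whose linear span is dense there and with $\|v^{(j,r)}\|\le1$. Let $\mathfrak M$ be the Banach space of bounded sequences $(h_{j,r})_{j\in\mathbb N,\,1\le r\le k}$ with the supremum norm, let $\mathcal M_\infty:S_A^{s,p}(D)\to\mathfrak M$, $\mathcal M_\infty u=(\langle u,v^{(j,r)}\rangle)_{j,r}$, let $\Pi_{kN}:\mathfrak M\to\mathbb R^{kN}$ be the projection to the entries with $j\le N$, and let $\mathcal M_{kN}=\Pi_{kN}\mathcal M_\infty$. Let $h^{(0)}\in\mathfrak M$, $1\le q\le\infty$, $1\le\tilde p<\infty$ (for instance $\tilde p=q$ if $q<\infty$), and, for $N\in\mathbb N$ and $g\in\mathbb R^{kN}$, $$F_{kN}(g)=\tfrac1q\,\|g-\Pi_{kN}h^{(0)}\|_{\ell_q}^{\tilde p}\ \text{ if } 1\le q<\infty,\qquad F_{kN}(g)=\|g-\Pi_{kN}h^{(0)}\|_{\ell_\infty}\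 \text{ if } q=\infty .$$ Let $b_N>0$ with $\lim_{N\to\infty}b_N=0$, and $$\mathcal F_{kN}(u)=F_{kN}(\mathcal M_{kN}u)+b_N\|u\|_{[W^{s,p}(D)]^k},\qquad u\in S_A^{s,p}(D).$$ Then $\mathcal F_{kN}$ has a minimizer on $S_A^{s,p}(D)$ for each $N\in\mathbb N$ and, for any choice of minimizers $u^{(0)}_{kN}$, $N\in\mathbb N$: the equation $\mathcal M_\infty u=h^{(0)}$ is solvable in $S_A^{s,p}(D)$ if and only if there is a constant $C_0>0$ with $\mathcal F_{kN}(u^{(0)}_{kN})\le C_0\,b_N$ for all $N\in\mathbb N$; and if the equation admits a solution $u^{(0)}_\infty$, then this solution is unique and $\{u^{(0)}_{kN}\}_{N\in\mathbb N}$ converges to it weakly in $S_A^{s,p}(D)$. -/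

import Mathlib

open MeasureTheory Filter Topology TopologicalSpace LineDeriv
open scoped ENNReal ContDiff Distributions

noncomputable section

namespace EllipticSol

/-- Euclidean space `ℝⁿ`. -/
abbrev Eucl (n : ℕ) : Type := EuclideanSpace ℝ (Fin n)

/-- The multi-indices `α ∈ ℤ₊ⁿ` with `|α| ≤ m`. -/
abbrev MultiIndex (n m : ℕ) : Type := {α : Fin n → Fin (m + 1) // ∑ i, (α i : ℕ) ≤ m}

namespace MultiIndex

variable {n m : ℕ}

/-- The exponents `(α₁, …, αₙ)`. -/
def exps (α : MultiIndex n m) : Fin n → ℕ := fun i => (α.1 i : ℕ)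

/-- The length `|α| = α₁ + … + αₙ`. -/
def len (α : MultiIndex n m) : ℕ := ∑ i, α.exps i

/-- The zero multi-index. -/
def zero : MultiIndex n m := ⟨fun _ => 0, by simp⟩

end MultiIndex

/-- The partial derivative `∂^α = ∂₁^{α₁} ⋯ ∂ₙ^{αₙ}`, on any space (test functions or
distributions) on which derivatives act continuously. -/
def partialD {n : ℕ} (V : Type*) [AddCommGroup V] [Module ℝ V] [TopologicalSpace V]
    [LineDeriv (Eucl n) V V] [LineDerivAdd (Eucl n) V V] [LineDerivSMul ℝ (Eucl n) V V]
    [ContinuousLineDeriv (Eucl n) V V] (α : Fin n → ℕ) : V →L[ℝ] V :=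
  (List.ofFn fun i => lineDerivOpCLM ℝ V (EuclideanSpace.single i (1 : ℝ) : Eucl n) ^ α i).prod

/-! ### Lebesgue spaces, distributions and Sobolev spaces -/

section Sobolev

variable {n : ℕ}

/-- `L^p(D)`. -/
abbrev LpOn (D : Opens (Eucl n)) (p : ℝ≥0∞) : Type :=
  Lp ℝ p (volume.restrict (D : Set (Eucl n)))

instance conjExponent_fact (p : ℝ≥0∞) [Fact (1 ≤ p)] : Fact (1 ≤ p.conjExponent) :=
  ⟨by simp [ENNReal.conjExponent]⟩

theorem LpOn.locallyIntegrableOn {D : Opens (Eucl n)} {p : ℝ≥0∞} [hp : Fact (1 ≤ p)]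
    (f : LpOn D p) :
    LocallyIntegrableOn f D (volume.restrict (D : Set (Eucl n))) :=
  ((Lp.memLp f).locallyIntegrable hp.out).locallyIntegrableOn _

theorem LpOn.integral_apply {D : Opens (Eucl n)} {p : ℝ≥0∞} [Fact (1 ≤ p)]
    (f : LpOn D p) (φ : 𝓓(D, ℝ)) :
    TestFunction.integralAgainstBilinCLM (ContinuousLinearMap.mul ℝ ℝ)
      (volume.restrict (D : Set (Eucl n))) f φ = ∫ x in (D : Set (Eucl n)), φ x * f x :=
  TestFunction.integralAgainstBilinCLM_eq_integral (LpOn.locallyIntegrableOn f)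

/-- The distribution `φ ↦ ∫_D f φ dx` given by `f ∈ L^p(D)`. -/
def LpOn.toDistribution (D : Opens (Eucl n)) (p : ℝ≥0∞) [Fact (1 ≤ p)] :
    LpOn D p →ₗ[ℝ] 𝓓'(D, ℝ) where
  toFun f := ContinuousLinearMap.toUniformConvergenceCLM _ _ _
    (TestFunction.integralAgainstBilinCLM
      (ContinuousLinearMap.mul ℝ ℝ) (volume.restrict (D : Set (Eucl n))) f)
  map_add' f g := by
    ext φ
    refine (LpOn.integral_apply _ φ).trans (Eq.trans ?_
      (congrArg₂ (· + ·) (LpOn.integral_apply f φ) (LpOn.integral_apply g φ)).symm)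
    refine Eq.trans ?_ (integral_add
      (TestFunction.integrable_bilin (ContinuousLinearMap.mul ℝ ℝ) (LpOn.locallyIntegrableOn f) φ)
      (TestFunction.integrable_bilin (ContinuousLinearMap.mul ℝ ℝ) (LpOn.locallyIntegrableOn g) φ))
    refine integral_congr_ae ?_
    filter_upwards [Lp.coeFn_add f g] with x hx
    simp only [hx]
    exact mul_add _ _ _
  map_smul' c f := by
    ext φ
    refine (LpOn.integral_apply _ φ).trans (Eq.trans ?_
      (congrArg (c • ·) (LpOn.integral_apply f φ)).symm)
    rw [← integral_smul]
    refine integral_congr_ae ?_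
    filter_upwards [Lp.coeFn_smul c f] with x hx
    simp [hx, mul_left_comm]

theorem LpOn.toDistribution_apply {D : Opens (Eucl n)} {p : ℝ≥0∞} [Fact (1 ≤ p)]
    (f : LpOn D p) (φ : 𝓓(D, ℝ)) :
    LpOn.toDistribution D p f φ = ∫ x in (D : Set (Eucl n)), φ x * f x :=
  TestFunction.integralAgainstBilinCLM_eq_integral (LpOn.locallyIntegrableOn f)

theorem testFunction_memLp {D : Opens (Eucl n)} (p : ℝ≥0∞) (φ : 𝓓(D, ℝ)) :
    MemLp φ p (volume.restrict (D : Set (Eucl n))) :=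
  φ.continuous.memLp_of_hasCompactSupport φ.hasCompactSupport

/-- The inclusion of `C₀^∞(D)` into `L^p(D)`. -/
def testToLp (D : Opens (Eucl n)) (p : ℝ≥0∞) [Fact (1 ≤ p)] : 𝓓(D, ℝ) →L[ℝ] LpOn D p :=
  TestFunction.mkCLM ℝ (fun φ => (testFunction_memLp p φ).toLp φ)
    (fun _ _ => rfl) (fun _ _ => rfl)
    (by
      intro K hK
      refine (ContDiffMapSupportedIn.mkCLMtoNormedSpace (𝕜 := ℝ)
        (fun f => (testFunction_memLp p (TestFunction.ofSupportedIn hK f)).toLp _)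
        (fun _ _ => rfl) (fun _ _ => rfl)
        ⟨{0}, (volume (K : Set (Eucl n))).toReal ^ p.toReal⁻¹, by positivity, fun f => ?_⟩).cont
      rw [Finset.sup_singleton, Lp.norm_toLp]
      have hsupp : Function.support (f : Eucl n → ℝ) ⊆ K := fun x hx => by
        by_contra h
        exact hx (f.zero_on_compl h)
      have hKfin : volume (K : Set (Eucl n)) ≠ ⊤ := K.isCompact.measure_lt_top.ne
      set C := ContDiffMapSupportedIn.seminorm ℝ (Eucl n) ℝ ⊤ K 0 f with hC
      have hC0 : 0 ≤ C := apply_nonneg _ _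
      have h1 : eLpNorm (f : Eucl n → ℝ) p (volume.restrict (D : Set (Eucl n))) ≤
          (volume (K : Set (Eucl n))) ^ p.toReal⁻¹ * ENNReal.ofReal C := by
        calc eLpNorm (f : Eucl n → ℝ) p (volume.restrict (D : Set (Eucl n)))
            ≤ eLpNorm (f : Eucl n → ℝ) p volume := eLpNorm_mono_measure _ Measure.restrict_le_self
          _ = eLpNorm (f : Eucl n → ℝ) p (volume.restrict (K : Set (Eucl n))) :=
              (eLpNorm_restrict_eq_of_support_subset hsupp).symm
          _ ≤ _ := by
              have := eLpNorm_le_of_ae_bound (p := p)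
                (μ := volume.restrict (K : Set (Eucl n))) (f := (f : Eucl n → ℝ)) (C := C)
                (Eventually.of_forall fun x =>
                  ContDiffMapSupportedIn.norm_apply_le_seminorm ℝ)
              simpa using this
      have h2 := ENNReal.toReal_mono (by finiteness) h1
      rw [ENNReal.toReal_mul, ENNReal.toReal_ofReal hC0, ← ENNReal.toReal_rpow] at h2
      exact h2)

theorem toDistribution_testToLp_lineDeriv (D : Opens (Eucl n)) (p : ℝ≥0∞) [Fact (1 ≤ p)]
    (v : Eucl n) (φ : 𝓓(D, ℝ)) :
    LpOn.toDistribution D p (testToLp D p (∂_{v} φ)) =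
      ∂_{v} (LpOn.toDistribution D p (testToLp D p φ)) := by
  have key : ∀ f g : 𝓓(D, ℝ), LpOn.toDistribution D p (testToLp D p f) g = ∫ x, g x * f x := by
    intro f g
    rw [LpOn.toDistribution_apply]
    have h1 : ∫ x in (D : Set (Eucl n)), g x * testToLp D p f x =
        ∫ x in (D : Set (Eucl n)), g x * f x := by
      refine integral_congr_ae ?_
      filter_upwards [(testFunction_memLp p f).coeFn_toLp] with x hx
      change g x * ((testFunction_memLp p f).toLp f : Eucl n → ℝ) x = _
      rw [hx]
    rw [h1]
    refine setIntegral_eq_integral_of_forall_compl_eq_zero fun x hx => ?_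
    rw [image_eq_zero_of_notMem_tsupport fun h => hx (g.tsupport_subset h), zero_mul]
  have hd : ∀ (f : 𝓓(D, ℝ)) (x : Eucl n), (∂_{v} f) x = fderiv ℝ f x v := by
    intro f x
    rw [TestFunction.lineDerivOp_eq_lineDerivCLM ℝ]
    simp only [TestFunction.lineDerivCLM_apply, le_refl, top_add, if_true]
    exact (f.contDiff.differentiable (by simp) x).lineDeriv_eq_fderiv
  have hi : ∀ f g : 𝓓(D, ℝ), Integrable fun x => f x * g x := fun f g =>
    (f.continuous.mul g.continuous).integrable_of_hasCompactSupport f.hasCompactSupport.mul_right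
  have hdiff : ∀ f : 𝓓(D, ℝ), Differentiable ℝ f := fun f =>
    f.contDiff.differentiable (by simp)
  ext ψ
  rw [Distribution.lineDerivOp_apply_apply, map_neg, key, key]
  simp only [hd]
  rw [integral_mul_fderiv_eq_neg_fderiv_mul_of_integrable]
  · simpa only [hd] using hi (∂_{v} ψ) φ
  · simpa only [hd] using hi ψ (∂_{v} φ)
  · exact hi ψ φ
  · exact fun x _ => hdiff ψ x
  · exact fun x _ => hdiff φ x

theorem toDistribution_testToLp_partialD (D : Opens (Eucl n)) (p : ℝ≥0∞) [Fact (1 ≤ p)]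
    (α : Fin n → ℕ) (φ : 𝓓(D, ℝ)) :
    LpOn.toDistribution D p (testToLp D p (partialD 𝓓(D, ℝ) α φ)) =
      partialD 𝓓'(D, ℝ) α (LpOn.toDistribution D p (testToLp D p φ)) := by
  have hpow : ∀ (v : Eucl n) (j : ℕ) (φ : 𝓓(D, ℝ)),
      LpOn.toDistribution D p (testToLp D p ((lineDerivOpCLM ℝ 𝓓(D, ℝ) v ^ j) φ)) =
      (lineDerivOpCLM ℝ 𝓓'(D, ℝ) v ^ j) (LpOn.toDistribution D p (testToLp D p φ)) := by
    intro v j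
    induction j with
    | zero => intro φ; rfl
    | succ j ih =>
      intro φ
      rw [pow_succ', pow_succ', mul_apply_eq_comp, mul_apply_eq_comp,
        lineDerivOpCLM_apply, lineDerivOpCLM_apply, toDistribution_testToLp_lineDeriv, ih]
  have hlist : ∀ (l : List (Fin n)) (φ : 𝓓(D, ℝ)),
      LpOn.toDistribution D p (testToLp D p ((l.map fun i => lineDerivOpCLM ℝ 𝓓(D, ℝ)
        (EuclideanSpace.single i (1 : ℝ) : Eucl n) ^ α i).prod φ)) =
      (l.map fun i => lineDerivOpCLM ℝ 𝓓'(D, ℝ)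
        (EuclideanSpace.single i (1 : ℝ) : Eucl n) ^ α i).prod
        (LpOn.toDistribution D p (testToLp D p φ)) := by
    intro l
    induction l with
    | nil => intro φ; rfl
    | cons i l ih =>
      intro φ
      rw [List.map_cons, List.map_cons, List.prod_cons, List.prod_cons,
        mul_apply_eq_comp, mul_apply_eq_comp, hpow, ih]
  simpa only [partialD, List.ofFn_eq_map] using hlist (List.finRange n) φ

/-- `W^{j,p}(D)` for an integer `j ≥ 0`. An element is the family `(∂^α u)_{|α| ≤ j}` of the
weak derivatives in `L^p(D)` of its member `u` at `α = 0`, so that the norm is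
`(∑_{|α| ≤ j} ‖∂^α u‖_{L^p(D)}^p)^{1/p}`. -/
def SobolevNat (D : Opens (Eucl n)) (p : ℝ≥0∞) [Fact (1 ≤ p)] (j : ℕ) :
    Submodule ℝ (PiLp p fun _ : MultiIndex n j => LpOn D p) where
  carrier := {g | ∀ α : MultiIndex n j, LpOn.toDistribution D p (g α) =
    partialD 𝓓'(D, ℝ) α.exps (LpOn.toDistribution D p (g MultiIndex.zero))}
  add_mem' {f g} hf hg α := by
    simp only [PiLp.add_apply, map_add, hf α, hg α]
  zero_mem' α := by simp
  smul_mem' c f hf α := by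
    simp only [PiLp.smul_apply, map_smul, hf α]

/-- The inclusion of `C₀^∞(D)` into `W^{j,p}(D)`. -/
def testToSobolev (D : Opens (Eucl n)) (p : ℝ≥0∞) [Fact (1 ≤ p)] (j : ℕ) :
    𝓓(D, ℝ) →L[ℝ] SobolevNat D p j :=
  ContinuousLinearMap.codRestrict
    ((PiLp.continuousLinearEquiv p ℝ (fun _ : MultiIndex n j => LpOn D p)).symm.toContinuousLinearMap.comp
      (ContinuousLinearMap.pi fun α : MultiIndex n j =>
        (testToLp D p).comp (partialD 𝓓(D, ℝ) α.exps)))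
    (SobolevNat D p j)
    (by
      intro φ α
      have h0 : partialD 𝓓(D, ℝ) (MultiIndex.zero : MultiIndex n j).exps φ = φ := by
        have : (List.ofFn fun i : Fin n => lineDerivOpCLM ℝ 𝓓(D, ℝ)
            (EuclideanSpace.single i (1 : ℝ) : Eucl n) ^
              (MultiIndex.zero : MultiIndex n j).exps i).prod = 1 := by
          refine List.prod_eq_one fun x hx => ?_
          obtain ⟨i, rfl⟩ := List.mem_ofFn.1 hx
          rfl
        rw [partialD, this]
        rfl
      change LpOn.toDistribution D p (testToLp D p (partialD 𝓓(D, ℝ) α.exps φ)) =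
        partialD 𝓓'(D, ℝ) α.exps (LpOn.toDistribution D p (testToLp D p
          (partialD 𝓓(D, ℝ) (MultiIndex.zero : MultiIndex n j).exps φ)))
      rw [h0, toDistribution_testToLp_partialD])

/-- `W_0^{j,p}(D)`, the closure of `C₀^∞(D)` in `W^{j,p}(D)`. -/
def SobolevZero (D : Opens (Eucl n)) (p : ℝ≥0∞) [Fact (1 ≤ p)] (j : ℕ) :
    Submodule ℝ (SobolevNat D p j) :=
  (LinearMap.range (testToSobolev D p j).toLinearMap).topologicalClosure

instance (D : Opens (Eucl n)) (p : ℝ≥0∞) [Fact (1 ≤ p)] (j : ℕ) :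
    NormedAddCommGroup (SobolevNat D p j) :=
  Submodule.normedAddCommGroup _

instance (D : Opens (Eucl n)) (p : ℝ≥0∞) [Fact (1 ≤ p)] (j : ℕ) :
    NormedSpace ℝ (SobolevNat D p j) :=
  Submodule.normedSpace _

instance (D : Opens (Eucl n)) (p : ℝ≥0∞) [Fact (1 ≤ p)] (j : ℕ) :
    NormedAddCommGroup (SobolevZero D p j) :=
  Submodule.normedAddCommGroup _

instance (D : Opens (Eucl n)) (p : ℝ≥0∞) [Fact (1 ≤ p)] (j : ℕ) :
    NormedSpace ℝ (SobolevZero D p j) :=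
  Submodule.normedSpace _

/-- The inclusion of `C₀^∞(D)` into `W_0^{j,p}(D)`. -/
def testToSobolevZero (D : Opens (Eucl n)) (p : ℝ≥0∞) [Fact (1 ≤ p)] (j : ℕ) :
    𝓓(D, ℝ) →L[ℝ] SobolevZero D p j :=
  (testToSobolev D p j).codRestrict (SobolevZero D p j)
    (fun φ => Submodule.le_topologicalClosure _ (LinearMap.mem_range_self _ φ))

/-- `W^{s,p}(D)` for `s ∈ ℤ`; for `s = -j < 0` it is the dual of `W_0^{j,p'}(D)`,
`1/p + 1/p' = 1`, with the dual norm. -/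
def Sobolev (D : Opens (Eucl n)) (p : ℝ≥0∞) [Fact (1 ≤ p)] : ℤ → Type
  | Int.ofNat j => SobolevNat D p j
  | Int.negSucc j => StrongDual ℝ (SobolevZero D p.conjExponent (j + 1))

instance (D : Opens (Eucl n)) (p : ℝ≥0∞) [Fact (1 ≤ p)] (s : ℤ) :
    NormedAddCommGroup (Sobolev D p s) :=
  match s with
  | Int.ofNat j => inferInstanceAs (NormedAddCommGroup (SobolevNat D p j))
  | Int.negSucc j => inferInstanceAs
      (NormedAddCommGroup (StrongDual ℝ (SobolevZero D p.conjExponent (j + 1))))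

instance (D : Opens (Eucl n)) (p : ℝ≥0∞) [Fact (1 ≤ p)] (s : ℤ) :
    NormedSpace ℝ (Sobolev D p s) :=
  match s with
  | Int.ofNat j => inferInstanceAs (NormedSpace ℝ (SobolevNat D p j))
  | Int.negSucc j => inferInstanceAs
      (NormedSpace ℝ (StrongDual ℝ (SobolevZero D p.conjExponent (j + 1))))

/-- The distribution on `D` given by an element of `W^{s,p}(D)`. -/
def Sobolev.toDistribution (D : Opens (Eucl n)) (p : ℝ≥0∞) [Fact (1 ≤ p)] (s : ℤ) :
    Sobolev D p s →ₗ[ℝ] 𝓓'(D, ℝ) :=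
  match s with
  | Int.ofNat j =>
      { toFun := fun g : SobolevNat D p j =>
          LpOn.toDistribution D p ((g : PiLp p fun _ : MultiIndex n j => LpOn D p)
            MultiIndex.zero)
        map_add' := fun f g => (LpOn.toDistribution D p).map_add _ _
        map_smul' := fun c f => (LpOn.toDistribution D p).map_smul c _ }
  | Int.negSucc j =>
      { toFun := fun T : StrongDual ℝ (SobolevZero D p.conjExponent (j + 1)) =>
          ContinuousLinearMap.toUniformConvergenceCLM _ _ _
            (T.comp (testToSobolevZero D p.conjExponent (j + 1)))
        map_add' := fun _ _ => rfl
        map_smul' := fun c T => by ext φ; rfl }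

end Sobolev

/-! ### Differential operators and their solutions -/

section Operators

variable {n k m : ℕ}

/-- The coefficients `(a_α)_{|α| ≤ m}` of a real `(k × k)`-matrix linear partial differential
operator `A = ∑_{|α| ≤ m} a_α(x) ∂^α` of order `≤ m` with `C^∞` coefficients over `X`. -/
structure DiffOp (n k m : ℕ) (X : Opens (Eucl n)) where
  coeff : MultiIndex n m → Eucl n → Matrix (Fin k) (Fin k) ℝ
  smooth : ∀ α i j, ContDiffOn ℝ ∞ (fun x => coeff α x i j) X

/-- The product of a test function by a function smooth on a larger open set. -/
def mulTest {X U : Opens (Eucl n)} (hU : U ≤ X) (a : Eucl n → ℝ) (ha : ContDiffOn ℝ ∞ a X)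
    (φ : 𝓓(U, ℝ)) : 𝓓(U, ℝ) where
  toFun x := a x * φ x
  contDiff' := by
    refine contDiff_iff_contDiffAt.2 fun x => ?_
    by_cases hx : x ∈ tsupport φ
    · have hxX : x ∈ X := hU (φ.tsupport_subset hx)
      exact (ha.contDiffAt (X.isOpen.mem_nhds hxX)).mul φ.contDiff.contDiffAt
    · refine (contDiffAt_const (c := (0 : ℝ))).congr_of_eventuallyEq ?_
      filter_upwards [(isClosed_tsupport φ).isOpen_compl.mem_nhds hx] with y hy
      rw [image_eq_zero_of_notMem_tsupport hy, mul_zero]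
  hasCompactSupport' := φ.hasCompactSupport.mul_left
  tsupport_subset' := (tsupport_mul_subset_right).trans φ.tsupport_subset

namespace DiffOp

variable {X : Opens (Eucl n)} (A : DiffOp n k m X)

/-- `(A φ)_i = ∑_j ∑_α a_{α,ij} ∂^α φ_j`, for test functions `φ` on `U ⊆ X`. -/
def onTest {U : Opens (Eucl n)} (hU : U ≤ X) (φ : Fin k → 𝓓(U, ℝ)) : Fin k → 𝓓(U, ℝ) :=
  fun i => ∑ j, ∑ α, mulTest hU (fun x => A.coeff α x i j) (A.smooth α i j)
    (partialD 𝓓(U, ℝ) α.exps (φ j))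

/-- The formal adjoint, `(A^* φ)_j = ∑_i ∑_α (-1)^{|α|} ∂^α (a_{α,ij} φ_i)`, for test functions
`φ` on `U ⊆ X`. -/
def adjointOnTest {U : Opens (Eucl n)} (hU : U ≤ X) (φ : Fin k → 𝓓(U, ℝ)) : Fin k → 𝓓(U, ℝ) :=
  fun j => ∑ i, ∑ α, (-1 : ℝ) ^ α.len • partialD 𝓓(U, ℝ) α.exps
    (mulTest hU (fun x => A.coeff α x i j) (A.smooth α i j) (φ i))

/-- `S_A(U)`: the `k`-columns of distributions `u` on `U` with `A u = 0` in `U`, that is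
`⟨u, A^* φ⟩ = 0` for all test functions `φ`. -/
def solutions {U : Opens (Eucl n)} (hU : U ≤ X) : Submodule ℝ (Fin k → 𝓓'(U, ℝ)) where
  carrier := {u | ∀ φ : Fin k → 𝓓(U, ℝ), ∑ j, u j (A.adjointOnTest hU φ j) = 0}
  add_mem' {u v} hu hv φ := by
    have h : ∑ j, (u j (A.adjointOnTest hU φ j) + v j (A.adjointOnTest hU φ j)) = 0 := by
      rw [Finset.sum_add_distrib, hu φ, hv φ, add_zero]
    exact h
  zero_mem' φ := Finset.sum_eq_zero fun _ _ => rfl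
  smul_mem' c u hu φ := by
    have h : ∑ j, c • u j (A.adjointOnTest hU φ j) = 0 := by
      rw [← Finset.smul_sum, hu φ, smul_zero]
    exact h

/-- `S_{A^*}(U)`: the `k`-columns of distributions `v` on `U` with `A^* v = 0` in `U`, that is
`⟨v, A φ⟩ = 0` for all test functions `φ`. -/
def adjointSolutions {U : Opens (Eucl n)} (hU : U ≤ X) : Set (Fin k → 𝓓'(U, ℝ)) :=
  {v | ∀ φ : Fin k → 𝓓(U, ℝ), ∑ j, v j (A.onTest hU φ j) = 0}

/-- Petrovskii ellipticity on `X` of `A` as an operator of order `m`: the principal symbol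
`σ(A)(x, ζ) = ∑_{|α| = m} a_α(x) (iζ)^α` is invertible for `x ∈ X` and real `ζ ≠ 0`. -/
def IsElliptic : Prop :=
  ∀ x ∈ X, ∀ ζ : Eucl n, ζ ≠ 0 →
    IsUnit (∑ α : MultiIndex n m with α.len = m,
      (∏ i, (Complex.I * (ζ i : ℂ)) ^ α.exps i) • (A.coeff α x).map Complex.ofReal)

/-- The column `u` of distributions on `U` vanishes on the open set `O`. -/
def VanishesOn {U : Opens (Eucl n)} (u : Fin k → 𝓓'(U, ℝ)) (O : Opens (Eucl n)) : Prop :=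
  ∀ j, ∀ φ : 𝓓(U, ℝ), tsupport φ ⊆ (O : Set (Eucl n)) → u j φ = 0

/-- The unique continuation property of `A` on `X`. -/
def UCP : Prop :=
  ∀ (U : Opens (Eucl n)) (hU : U ≤ X), IsConnected (U : Set (Eucl n)) →
    ∀ u ∈ A.solutions hU, ∀ O : Opens (Eucl n), O ≤ U → (O : Set (Eucl n)).Nonempty →
      VanishesOn u O → u = 0

/-- The unique continuation property of `A^*` on `X`. -/
def AdjointUCP : Prop :=
  ∀ (U : Opens (Eucl n)) (hU : U ≤ X), IsConnected (U : Set (Eucl n)) →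
    ∀ v ∈ A.adjointSolutions hU, ∀ O : Opens (Eucl n), O ≤ U → (O : Set (Eucl n)).Nonempty →
      VanishesOn v O → v = 0

/-- `S_A^{s,p}(D) = S_A(D) ∩ [W^{s,p}(D)]^k`, with the norm of `[W^{s,p}(D)]^k`, which is
`(∑_j ‖u_j‖_{W^{s,p}(D)}^p)^{1/p}`. -/
def sobolevSolutions {D : Opens (Eucl n)} (hD : D ≤ X) (s : ℤ) (p : ℝ≥0∞) [Fact (1 ≤ p)] :
    Submodule ℝ (PiLp p fun _ : Fin k => Sobolev D p s) where
  carrier := {u | (fun j => Sobolev.toDistribution D p s (u j)) ∈ A.solutions hD}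
  add_mem' {u v} hu hv := by
    simpa [Pi.add_def] using (A.solutions hD).add_mem hu hv
  zero_mem' := by
    simpa [Pi.zero_def] using (A.solutions hD).zero_mem
  smul_mem' c u hu := by
    simpa [Pi.smul_def] using (A.solutions hD).smul_mem c hu

end DiffOp

end Operators

/-! ### Domains -/

section Domains

variable {n : ℕ}

/-- `∂D ∈ C^∞`: near each boundary point, `D` is a sublevel set `{ρ < 0}` of a smooth function
`ρ` with nonvanishing gradient. -/
def HasSmoothBoundary (D : Set (Eucl n)) : Prop :=
  ∀ x₀ ∈ frontier D, ∃ (U : Set (Eucl n)) (ρ : Eucl n → ℝ), IsOpen U ∧ x₀ ∈ U ∧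
    ContDiffOn ℝ ∞ ρ U ∧ (∀ x ∈ U, fderiv ℝ ρ x ≠ 0) ∧ D ∩ U = {x ∈ U | ρ x < 0}

/-- The set `S` has no compact connected components. -/
def NoCompactComponents (S : Set (Eucl n)) : Prop :=
  ∀ x ∈ S, ¬ IsCompact (connectedComponentIn S x)

end Domains

/-! ### The data operators and the variational problem -/

section Variational

variable {S : Type*} [NormedAddCommGroup S] [NormedSpace ℝ S] {k : ℕ}

/-- The Banach space `𝔐` of bounded sequences `h = (h_{ν,r})`, `ν ∈ ℕ`, `1 ≤ r ≤ k`, with the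
supremum norm. -/
abbrev BddSeq (k : ℕ) : Type := lp (fun _ : ℕ × Fin k => ℝ) ⊤

/-- The continuous linear map `M_∞ : S → 𝔐`, `u ↦ (⟨u, v^{(ν,r)}⟩)_{ν,r}`. -/
def dataMapInfty (v : ℕ × Fin k → StrongDual ℝ S) (hv : ∀ i, ‖v i‖ ≤ 1) : S →L[ℝ] BddSeq k :=
  LinearMap.mkContinuous
    { toFun := fun u => ⟨fun i => v i u, memℓp_infty ⟨‖u‖, by
        rintro _ ⟨i, rfl⟩
        exact (v i).le_of_opNorm_le (hv i) u |>.trans_eq (one_mul _)⟩⟩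
      map_add' := fun u w => by ext i; exact (v i).map_add u w
      map_smul' := fun c u => by ext i; exact (v i).map_smul c u }
    1 (fun u => lp.norm_le_of_forall_le (by positivity) fun i =>
      (v i).le_of_opNorm_le (hv i) u)

/-- The map `M_{kN} : S → ℝ^{kN}`, `u ↦ (⟨u, v^{(ν,r)}⟩)_{ν,r}` over the first `N` indices `ν`
and `1 ≤ r ≤ k`. -/
def dataMap (v : ℕ × Fin k → StrongDual ℝ S) (N : ℕ) : S →L[ℝ] (Fin N × Fin k → ℝ) :=
  ContinuousLinearMap.pi fun i => v ((i.1 : ℕ), i.2)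

/-- The projection `Π_{kN} : 𝔐 → ℝ^{kN}`. -/
def proj (N : ℕ) (h : BddSeq k) : Fin N × Fin k → ℝ := fun i => h ((i.1 : ℕ), i.2)

/-- The distance-to-data functional `F_{kN}` on `ℝ^{kN}`:
`F_{kN}(g) = (1/q) ‖g - Π_{kN} h‖_q^t` if `1 ≤ q < ∞`, `F_{kN}(g) = ‖g - Π_{kN} h‖_∞` if `q = ∞`. -/
def dataFit (q : ℝ≥0∞) (t : ℝ) (h : BddSeq k) (N : ℕ) (g : Fin N × Fin k → ℝ) : ℝ :=
  if q = ⊤ then ‖WithLp.toLp q (g - proj N h)‖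
  else (1 / q.toReal) * ‖WithLp.toLp q (g - proj N h)‖ ^ t

/-- The functional `𝓕(u) = F(M u) + b ‖u‖`. -/
def regularized {V : Type*} (F : V → ℝ) (M : S → V) (b : ℝ) (u : S) : ℝ := F (M u) + b * ‖u‖

/-- `u` minimizes `f` over the whole space. -/
def IsMinimizer (f : S → ℝ) (u : S) : Prop := ∀ w, f u ≤ f w

end Variational

end EllipticSol

end

open EllipticSol

/-!
The theorem rests on two facts about `S = S_A^{s,p}(D)`: it is reflexive, and the functionals
`v^{(j,r)}` span a dense subspace of its dual.

*Reflexivity.* For `1 < p < ∞` the space `L^p` is uniformly convex (`uniformConvexSpace_Lp`): the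
strict convexity of `|x|^p` yields, by homogeneity and compactness, a scalar inequality that can be
integrated (`exists_abs_sub_rpow_le`). Hence `L^p` is reflexive by the Milman–Pettis theorem
(`isReflexiveSpace_of_uniformConvexSpace`). Reflexivity passes to finite `ℓ^p` sums, closed
subspaces and duals, so `W^{s,p}(D)` is reflexive both for `s ≥ 0`, where it is a closed subspace
of a finite sum of copies of `L^p(D)`, and for `s < 0`, where it is the dual of a space of that
kind with exponent `p'`. The equation `A u = 0` is tested against each test function by a
functional continuous on `[W^{s,p}(D)]^k`, so `S` is closed there, and reflexive
(`isReflexiveSpace_sobolevSolutions`).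

*Minimizers* exist by the direct method: minimizing sequences are bounded because `b_N > 0`,
bounded sequences converge weakly along an ultrafilter, the data fit is a continuous function of
finitely many functionals, and the norm is weakly lower semicontinuous.

*Solvability.* At a solution `w` the data fit vanishes, so the minimal value is at most `‖w‖ b_N`.
Conversely, minimal values bounded by `C₀ b_N` force `‖u_N‖ ≤ C₀` and, since `b_N → 0`, force
`⟨u_N, v^{(j,r)}⟩ → h_{j,r}` (`norm_le_and_tendsto_of_regularized_le`); any weak limit along an
ultrafilter then solves the equation. Uniqueness holds because functionals with dense span separate
points, and weak convergence of the whole sequence because a bounded sequence need only be tested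
against such functionals (`tendsto_toWeakSpace_of_dense_span`).
-/

namespace EllipticSol

/-! ### Reflexive spaces -/

section Reflexive

variable {E : Type*} [NormedAddCommGroup E] [NormedSpace ℝ E]

variable (E) in
/-- A real normed space is reflexive if the canonical embedding into its bidual is onto. -/
def IsReflexiveSpace : Prop :=
  Function.Surjective (NormedSpace.inclusionInDoubleDual ℝ E)

theorem IsReflexiveSpace.exists_eq (hE : IsReflexiveSpace E)
    (φ : StrongDual ℝ (StrongDual ℝ E)) : ∃ x : E, ∀ f : StrongDual ℝ E, f x = φ f := by
  obtain ⟨x, rfl⟩ := hE φ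
  exact ⟨x, fun f => rfl⟩

theorem isReflexiveSpace_of_exists
    (hE : ∀ φ : StrongDual ℝ (StrongDual ℝ E), ∃ x : E, ∀ f : StrongDual ℝ E, f x = φ f) :
    IsReflexiveSpace E := fun φ => by
  obtain ⟨x, hx⟩ := hE φ
  exact ⟨x, by ext f; exact hx f⟩

/-- The point of `E` representing a functional on the dual of the subspace lies in the subspace:
otherwise a functional vanishing on the subspace would separate it. -/
theorem IsReflexiveSpace.submodule (hE : IsReflexiveSpace E) (V : Submodule ℝ E)
    (hV : IsClosed (V : Set E)) : IsReflexiveSpace V := by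
  refine isReflexiveSpace_of_exists fun φ => ?_
  let R : StrongDual ℝ E →L[ℝ] StrongDual ℝ V :=
    (ContinuousLinearMap.compL ℝ V E ℝ).flip V.subtypeL
  obtain ⟨x, hx⟩ := hE.exists_eq (φ.comp R)
  have hxV : x ∈ V := by
    by_contra hxV
    obtain ⟨f, u, hfu, hux⟩ := geometric_hahn_banach_closed_point V.convex hV hxV
    have hzero : ∀ y ∈ V, f y = 0 := by
      intro y hy
      by_contra hne
      have := hfu ((u / f y) • y) (V.smul_mem _ hy)
      rw [map_smul, smul_eq_mul, div_mul_cancel₀ _ hne] at this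
      exact lt_irrefl _ this
    have hR : R f = 0 := by
      ext y
      exact hzero y y.2
    have h0 : f x = 0 := by
      rw [hx f, ContinuousLinearMap.comp_apply, hR, map_zero]
    have := hfu 0 V.zero_mem
    rw [map_zero] at this
    linarith
  refine ⟨⟨x, hxV⟩, fun g => ?_⟩
  obtain ⟨f, hf, -⟩ := exists_extension_norm_eq V g
  have hR : R f = g := by
    ext y
    exact hf y
  rw [← hf ⟨x, hxV⟩, hx f, ContinuousLinearMap.comp_apply, hR]

theorem IsReflexiveSpace.strongDual (hE : IsReflexiveSpace E) :
    IsReflexiveSpace (StrongDual ℝ E) := by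
  refine isReflexiveSpace_of_exists fun ψ => ?_
  refine ⟨ψ.comp (NormedSpace.inclusionInDoubleDual ℝ E), fun φ => ?_⟩
  obtain ⟨x, rfl⟩ := hE φ
  rfl

theorem IsReflexiveSpace.piLp {ι : Type*} [Fintype ι] {G : ι → Type*}
    [∀ i, NormedAddCommGroup (G i)] [∀ i, NormedSpace ℝ (G i)] (p : ℝ≥0∞) [Fact (1 ≤ p)]
    (hG : ∀ i, IsReflexiveSpace (G i)) : IsReflexiveSpace (PiLp p G) := by
  classical
  refine isReflexiveSpace_of_exists fun φ => ?_
  choose x hx using fun i => (hG i).exists_eq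
    (φ.comp ((ContinuousLinearMap.compL ℝ (PiLp p G) (G i) ℝ).flip (PiLp.proj p G i)))
  refine ⟨WithLp.toLp p x, fun f => ?_⟩
  let incl : ∀ i, G i →L[ℝ] PiLp p G := fun i =>
    ((PiLp.continuousLinearEquiv p ℝ G).symm.toContinuousLinearMap).comp
      (ContinuousLinearMap.single ℝ G i)
  have hsum : ∀ y : PiLp p G, f y = ∑ i, f (incl i (y i)) := by
    intro y
    rw [← map_sum]
    congr 1
    apply (PiLp.continuousLinearEquiv p ℝ G).injective
    rw [map_sum]
    ext j
    simp [incl, Finset.sum_apply]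
  have hf : f = ∑ i, (f.comp (incl i)).comp (PiLp.proj p G i) := by
    ext y
    rw [hsum y]
    simp
  rw [hsum]
  conv_rhs => rw [hf, map_sum]
  exact Finset.sum_congr rfl fun i _ => hx i (f.comp (incl i))

/-- In a reflexive space every bounded family converges weakly along every ultrafilter. -/
theorem IsReflexiveSpace.exists_tendsto (hE : IsReflexiveSpace E) {ι : Type*} (l : Ultrafilter ι)
    (x : ι → E) (C : ℝ) (hx : ∀ᶠ i in (l : Filter ι), ‖x i‖ ≤ C) :
    ∃ x₀ : E, ∀ f : StrongDual ℝ E, Tendsto (fun i => f (x i)) l (𝓝 (f x₀)) := by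
  have hbd : ∀ f : StrongDual ℝ E, ∀ᶠ i in (l : Filter ι), ‖f (x i)‖ ≤ ‖f‖ * C := fun f =>
    hx.mono fun i hi => f.le_of_opNorm_le_of_le le_rfl hi
  have hlim : ∀ f : StrongDual ℝ E, ∃ c, Tendsto (fun i => f (x i)) l (𝓝 c) := by
    intro f
    have hmem : (l.map fun i => f (x i) : Filter ℝ) ≤ 𝓟 (Metric.closedBall 0 (‖f‖ * C)) := by
      refine le_principal_iff.2 ?_
      exact (hbd f).mono fun i hi => by simpa using hi
    obtain ⟨c, -, hc⟩ := (isCompact_closedBall (0 : ℝ) (‖f‖ * C)).ultrafilter_le_nhds _ hmem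
    exact ⟨c, hc⟩
  choose φ hφ using hlim
  let Φ : StrongDual ℝ (StrongDual ℝ E) := LinearMap.mkContinuous
    { toFun := φ
      map_add' := fun f g => tendsto_nhds_unique (hφ (f + g)) ((hφ f).add (hφ g))
      map_smul' := fun c f => tendsto_nhds_unique (hφ (c • f)) ((hφ f).const_smul c) } C
    (fun f => by
      rw [mul_comm]
      exact le_of_tendsto (hφ f).norm (hbd f))
  obtain ⟨x₀, hx₀⟩ := hE.exists_eq Φ
  refine ⟨x₀, fun f => ?_⟩
  rw [hx₀ f]
  exact hφ f

/-- **Helly's theorem**: finitely many values of a functional on the dual, of norm at most `1`,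
are approximately attained at a single point of the unit ball. -/
theorem exists_forall_abs_sub_lt_of_doubleDual (φ : StrongDual ℝ (StrongDual ℝ E)) (hφ : ‖φ‖ ≤ 1)
    {ι : Type*} [Fintype ι] (f : ι → StrongDual ℝ E) {η : ℝ} (hη : 0 < η) :
    ∃ x : E, ‖x‖ ≤ 1 ∧ ∀ i, |f i x - φ (f i)| < η := by
  classical
  let T : E →L[ℝ] (ι → ℝ) := ContinuousLinearMap.pi f
  let y : ι → ℝ := fun i => φ (f i)
  have hconv : Convex ℝ (closure (T '' Metric.closedBall 0 1)) :=
    ((convex_closedBall (0 : E) 1).linear_image T.toLinearMap).closure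
  have hy : y ∈ closure (T '' Metric.closedBall 0 1) := by
    by_contra hy
    obtain ⟨g, u, hgu, huy⟩ := geometric_hahn_banach_closed_point hconv isClosed_closure hy
    have hball : ∀ x : E, ‖x‖ ≤ 1 → g (T x) < u := fun x hx =>
      hgu _ (subset_closure ⟨x, by simpa using hx, rfl⟩)
    have hu : 0 < u := by simpa using hball 0 (by simp)
    have hnorm : ‖g.comp T‖ ≤ u := by
      refine ContinuousLinearMap.opNorm_le_of_unit_norm hu.le fun x hx => ?_
      have h1 := hball x hx.le
      have h2 := hball (-x) (by rw [norm_neg, hx])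
      rw [map_neg, map_neg] at h2
      exact abs_le.2 ⟨by simp only [ContinuousLinearMap.comp_apply]; linarith, h1.le⟩
    have hg : ∀ z : ι → ℝ, g z = ∑ i, z i * g (Pi.single i 1) := by
      intro z
      conv_lhs => rw [pi_eq_sum_univ' z, map_sum]
      refine Finset.sum_congr rfl fun i _ => ?_
      rw [map_smul, smul_eq_mul]
    have hcomp : g.comp T = ∑ i, g (Pi.single i 1) • f i := by
      ext x
      rw [ContinuousLinearMap.comp_apply, hg]
      simp [T, mul_comm]
    have hval : g y = φ (g.comp T) := by
      rw [hcomp, map_sum, hg]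
      simp [y, mul_comm]
    have h3 : φ (g.comp T) ≤ 1 * ‖g.comp T‖ :=
      (le_abs_self _).trans (φ.le_of_opNorm_le hφ _)
    linarith
  obtain ⟨_, ⟨x, hx, rfl⟩, hxy⟩ := Metric.mem_closure_iff.1 hy η hη
  refine ⟨x, by simpa using hx, fun i => ?_⟩
  have := (dist_pi_lt_iff hη).1 hxy i
  rwa [dist_comm, Real.dist_eq] at this

/-- **Milman–Pettis**, for a functional of norm one. By Helly's theorem the points of the unit
ball at which finitely many functionals nearly take the values prescribed by `φ` form a filter
base. Points at which a functional `f` with `‖f‖ ≤ 1` and `φ f` close to `1` nearly takes the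
value `φ f` have midpoints of norm close to `1`, so by uniform convexity they are close to each
other, and the filter is Cauchy. -/
theorem exists_eq_of_norm_doubleDual_eq_one [UniformConvexSpace E] [CompleteSpace E]
    (φ : StrongDual ℝ (StrongDual ℝ E)) (hφ : ‖φ‖ = 1) :
    ∃ x : E, ∀ f : StrongDual ℝ E, f x = φ f := by
  classical
  let J : Metric.closedBall (0 : E) 1 → StrongDual ℝ E → ℝ := fun x f => f x
  let l : Filter (Metric.closedBall (0 : E) 1) := comap J (𝓝 fun f => φ f)
  have hl : l.NeBot := by
    refine comap_neBot_iff.2 fun t ht => ?_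
    rw [nhds_pi, Filter.mem_pi] at ht
    obtain ⟨I, hI, U, hU, hUt⟩ := ht
    choose η hη hηU using fun f => Metric.mem_nhds_iff.1 (hU f)
    have := hI.fintype
    obtain ⟨η₀, hη₀, hle⟩ : ∃ η₀ > 0, ∀ f ∈ I, η₀ ≤ η f := by
      rcases I.eq_empty_or_nonempty with rfl | hne
      · exact ⟨1, one_pos, by simp⟩
      · obtain ⟨f₀, hf₀, hmin⟩ := hI.exists_minimalFor η I hne
        refine ⟨η f₀, hη f₀, fun f hf => ?_⟩
        rcases le_total (η f₀) (η f) with h | h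
        · exact h
        · exact hmin hf h
    obtain ⟨x, hx, hxf⟩ :=
      exists_forall_abs_sub_lt_of_doubleDual φ hφ.le (fun f : I => (f : StrongDual ℝ E)) hη₀
    refine ⟨⟨x, by simpa using hx⟩, hUt fun f hf => hηU f ?_⟩
    exact (hxf ⟨f, hf⟩).trans_le (hle f hf)
  have hlim : ∀ f : StrongDual ℝ E,
      Tendsto (fun x : Metric.closedBall (0 : E) 1 => f x) l (𝓝 (φ f)) := fun f =>
    (tendsto_pi_nhds.1 (tendsto_comap : Tendsto J l _)) f
  have hcauchy : Cauchy (l.map ((↑) : Metric.closedBall (0 : E) 1 → E)) := by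
    refine Metric.cauchy_iff.2 ⟨hl.map _, fun ε hε => ?_⟩
    obtain ⟨δ, hδ, huc⟩ := exists_forall_closed_ball_dist_add_le_two_sub E hε
    obtain ⟨f, hf1, hf⟩ : ∃ f : StrongDual ℝ E, ‖f‖ ≤ 1 ∧ 1 - δ / 2 < φ f := by
      by_contra! hcon
      have hle : ‖φ‖ ≤ max (1 - δ / 2) 0 := by
        refine ContinuousLinearMap.opNorm_le_of_unit_norm (le_max_right _ _) fun f hf => ?_
        have h1 := hcon f hf.le
        have h2 := hcon (-f) (by rw [norm_neg, hf])
        rw [map_neg] at h2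
        exact (abs_le.2 ⟨by linarith, h1⟩).trans (le_max_left _ _)
      rw [hφ] at hle
      rcases le_max_iff.1 hle with h | h <;> linarith
    refine ⟨_, image_mem_map ((hlim f).eventually_const_lt hf), ?_⟩
    rintro _ ⟨x, hx, rfl⟩ _ ⟨y, hy, rfl⟩
    by_contra! hxy
    rw [dist_eq_norm] at hxy
    have h1 := huc (mem_closedBall_zero_iff.1 x.2) (mem_closedBall_zero_iff.1 y.2) hxy
    have h2 : f ((x : E) + y) ≤ 1 * ‖(x : E) + y‖ :=
      (le_abs_self _).trans (f.le_of_opNorm_le hf1 _)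
    rw [map_add] at h2
    simp only [Set.mem_ofPred_eq] at hx hy
    linarith
  obtain ⟨x, hx⟩ := CompleteSpace.complete hcauchy
  exact ⟨x, fun f => tendsto_nhds_unique ((f.continuous.tendsto x).comp hx) (hlim f)⟩

-- The scalar multiplication on the iterated dual is found only at this search depth.
set_option maxSynthPendingDepth 3 in
/-- The **Milman–Pettis theorem**. -/
theorem isReflexiveSpace_of_uniformConvexSpace [UniformConvexSpace E] [CompleteSpace E] :
    IsReflexiveSpace E := by
  refine isReflexiveSpace_of_exists fun φ => ?_
  rcases eq_or_ne φ 0 with rfl | hφ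
  · exact ⟨0, fun f => by simp⟩
  have hne : ‖φ‖ ≠ 0 := fun h => hφ ((ContinuousLinearMap.opNorm_zero_iff φ).1 h)
  obtain ⟨x, hx⟩ := exists_eq_of_norm_doubleDual_eq_one (‖φ‖⁻¹ • φ)
    (by rw [norm_smul, norm_inv, norm_norm, inv_mul_cancel₀ hne])
  refine ⟨‖φ‖ • x, fun f => ?_⟩
  rw [map_smul, hx f, smul_apply, smul_smul, mul_inv_cancel₀ hne, one_smul]

end Reflexive

/-! ### Uniform convexity of `L^p` -/

section UniformConvexity

theorem abs_rpow_midpoint_lt {r : ℝ} (hr : 1 < r) {a b : ℝ} (hab : a ≠ b) :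
    |(a + b) / 2| ^ r < (|a| ^ r + |b| ^ r) / 2 := by
  have hr0 : 0 < r := by linarith
  have htri : |(a + b) / 2| ≤ (|a| + |b|) / 2 := by
    rw [abs_div, abs_two]
    gcongr
    exact abs_add_le a b
  rcases eq_or_ne |a| |b| with h | h
  · rcases abs_eq_abs.1 h with h' | h'
    · exact absurd h' hab
    · have hb : b ≠ 0 := by
        rintro rfl
        exact hab (by simpa using h')
      have : 0 < |b| ^ r := Real.rpow_pos_of_pos (abs_pos.2 hb) r
      rw [h, h', neg_add_cancel, zero_div, abs_zero, Real.zero_rpow hr0.ne']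
      linarith
  · have h1 := (strictConvexOn_rpow hr).2 (abs_nonneg a) (abs_nonneg b) h
      (by norm_num : (0 : ℝ) < 1 / 2) (by norm_num : (0 : ℝ) < 1 / 2) (by norm_num)
    simp only [smul_eq_mul] at h1
    calc |(a + b) / 2| ^ r ≤ ((|a| + |b|) / 2) ^ r := by gcongr
      _ = (1 / 2 * |a| + 1 / 2 * |b|) ^ r := by ring_nf
      _ < 1 / 2 * |a| ^ r + 1 / 2 * |b| ^ r := h1
      _ = _ := by ring

/-- A scalar form of uniform convexity: up to an arbitrarily small multiple of
`|a|^r + |b|^r`, the convexity defect of `|x|^r` at the midpoint controls `|a - b|^r`. It follows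
by homogeneity and compactness from strict convexity, and it can be integrated. -/
theorem exists_abs_sub_rpow_le {r : ℝ} (hr : 1 < r) {ε : ℝ} (hε : 0 < ε) :
    ∃ C : ℝ, 0 < C ∧ ∀ a b : ℝ, |a - b| ^ r ≤ ε * (|a| ^ r + |b| ^ r) +
      C * ((|a| ^ r + |b| ^ r) / 2 - |(a + b) / 2| ^ r) := by
  have hr0 : 0 < r := by linarith
  let g : ℝ × ℝ → ℝ := fun z => (|z.1| ^ r + |z.2| ^ r) / 2 - |(z.1 + z.2) / 2| ^ r
  let d : ℝ × ℝ → ℝ := fun z => |z.1 - z.2| ^ r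
  let N : ℝ × ℝ → ℝ := fun z => |z.1| ^ r + |z.2| ^ r
  have hpow : ∀ u : ℝ × ℝ → ℝ, Continuous u → Continuous fun z => |u z| ^ r := fun u hu =>
    hu.abs.rpow_const fun _ => Or.inr hr0.le
  have hN : Continuous N := (hpow _ continuous_fst).add (hpow _ continuous_snd)
  have hd : Continuous d := hpow _ (continuous_fst.sub continuous_snd)
  have hg : Continuous g :=
    (hN.div_const 2).sub (hpow _ ((continuous_fst.add continuous_snd).div_const 2))
  have hg0 : ∀ z, 0 ≤ g z := by
    intro z
    rcases eq_or_ne z.1 z.2 with h | h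
    · have : (z.2 + z.2) / 2 = z.2 := by ring
      simp only [g, h, this]
      linarith
    · exact (sub_pos.2 (abs_rpow_midpoint_lt hr h)).le
  have hsphere : ∃ C : ℝ, 0 < C ∧ ∀ z ∈ Metric.sphere (0 : ℝ × ℝ) 1,
      d z ≤ ε * N z + C * g z := by
    let K : Set (ℝ × ℝ) := Metric.sphere 0 1 ∩ {z | ε * N z ≤ d z}
    have hK : IsCompact K :=
      (isCompact_sphere _ _).inter_right (isClosed_le (hN.const_mul ε) hd)
    rcases K.eq_empty_or_nonempty with hKe | hKne
    · refine ⟨1, one_pos, fun z hz => ?_⟩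
      have hz' : ¬ ε * N z ≤ d z := fun h => (hKe ▸ (⟨hz, h⟩ : z ∈ K) : z ∈ (∅ : Set (ℝ × ℝ)))
      linarith [hg0 z]
    · obtain ⟨z₀, hz₀, hmin⟩ := hK.exists_isMinOn hKne hg.continuousOn
      obtain ⟨z₁, -, hmax⟩ := hK.exists_isMaxOn hKne hd.continuousOn
      have hc : 0 < g z₀ := by
        refine sub_pos.2 (abs_rpow_midpoint_lt hr fun h => ?_)
        have hz0 : z₀ ≠ 0 := by
          rintro rfl
          simpa using hz₀.1
        have hNpos : 0 < N z₀ := by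
          have h1 : z₀.1 ≠ 0 := fun h1 => hz0 (Prod.ext h1 (h ▸ h1))
          have h2 : 0 < |z₀.1| ^ r := Real.rpow_pos_of_pos (abs_pos.2 h1) r
          have h3 : 0 ≤ |z₀.2| ^ r := by positivity
          exact add_pos_of_pos_of_nonneg h2 h3
        have h4 : ε * N z₀ ≤ d z₀ := hz₀.2
        have h5 : d z₀ = 0 := by
          simp [d, h, Real.zero_rpow hr0.ne']
        nlinarith [mul_pos hε hNpos]
      have hd1 : 0 ≤ d z₁ := by positivity
      refine ⟨(d z₁ + 1) / g z₀, by positivity, fun z hz => ?_⟩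
      have hNz : 0 ≤ N z := by positivity
      by_cases hzK : ε * N z ≤ d z
      · have h1 : d z ≤ d z₁ := hmax (⟨hz, hzK⟩ : z ∈ K)
        have h2 : g z₀ ≤ g z := hmin (⟨hz, hzK⟩ : z ∈ K)
        have h3 : (d z₁ + 1) / g z₀ * g z₀ ≤ (d z₁ + 1) / g z₀ * g z := by gcongr
        rw [div_mul_cancel₀ _ hc.ne'] at h3
        nlinarith [mul_nonneg hε.le hNz]
      · have : 0 ≤ (d z₁ + 1) / g z₀ * g z := mul_nonneg (by positivity) (hg0 z)
        linarith
  obtain ⟨C, hC, hCs⟩ := hsphere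
  refine ⟨C, hC, fun a b => ?_⟩
  rcases eq_or_ne ((a, b) : ℝ × ℝ) 0 with h0 | h0
  · obtain ⟨rfl, rfl⟩ := Prod.mk_eq_zero.1 h0
    simp [Real.zero_rpow hr0.ne']
  set R := ‖((a, b) : ℝ × ℝ)‖ with hR
  have hRpos : 0 < R := norm_pos_iff.2 h0
  have key := hCs (R⁻¹ • (a, b)) (by
    rw [mem_sphere_zero_iff_norm, norm_smul, norm_inv, Real.norm_of_nonneg hRpos.le, ← hR,
      inv_mul_cancel₀ hRpos.ne'])
  have hscale : ∀ x : ℝ, |R⁻¹ * x| ^ r = (R⁻¹) ^ r * |x| ^ r := fun x => by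
    rw [abs_mul, abs_of_pos (inv_pos.2 hRpos), Real.mul_rpow (by positivity) (abs_nonneg x)]
  have hs : 0 < (R⁻¹) ^ r := by positivity
  have e1 : R⁻¹ * a - R⁻¹ * b = R⁻¹ * (a - b) := by ring
  have e2 : (R⁻¹ * a + R⁻¹ * b) / 2 = R⁻¹ * ((a + b) / 2) := by ring
  simp only [d, N, g, Prod.smul_mk, smul_eq_mul, e1, e2, hscale] at key
  refine le_of_mul_le_mul_left (key.trans_eq ?_) hs
  ring

variable {Ω : Type*} [MeasurableSpace Ω] {μ : Measure Ω} {p : ℝ≥0∞}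

theorem Lp_norm_rpow_eq_integral (hp0 : p ≠ 0) (hp : p ≠ ⊤) (f : Lp ℝ p μ) :
    ‖f‖ ^ p.toReal = ∫ x, |f x| ^ p.toReal ∂μ := by
  have hr : 0 < p.toReal := ENNReal.toReal_pos hp0 hp
  have hnn : 0 ≤ ∫ x, ‖f x‖ ^ p.toReal ∂μ := integral_nonneg fun x => by positivity
  rw [Lp.norm_def, (Lp.memLp f).eLpNorm_eq_integral_rpow_norm hp0 hp,
    ENNReal.toReal_ofReal (by positivity), Real.rpow_inv_rpow hnn hr.ne']
  rfl

theorem Lp_integrable_rpow (hp0 : p ≠ 0) (hp : p ≠ ⊤) (f : Lp ℝ p μ) :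
    Integrable (fun x => |f x| ^ p.toReal) μ :=
  (Lp.memLp f).integrable_norm_rpow hp0 hp

theorem Lp_exists_norm_sub_rpow_le [Fact (1 ≤ p)] (hp1 : 1 < p) (hp : p ≠ ⊤) {ε : ℝ}
    (hε : 0 < ε) :
    ∃ C : ℝ, 0 < C ∧ ∀ f g : Lp ℝ p μ, ‖f - g‖ ^ p.toReal ≤
      ε * (‖f‖ ^ p.toReal + ‖g‖ ^ p.toReal) +
      C * ((‖f‖ ^ p.toReal + ‖g‖ ^ p.toReal) / 2 - ‖(2⁻¹ : ℝ) • (f + g)‖ ^ p.toReal) := by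
  have hp0 : p ≠ 0 := (zero_lt_one.trans hp1).ne'
  have hr : 1 < p.toReal := by
    rw [← ENNReal.toReal_one]
    exact (ENNReal.toReal_lt_toReal ENNReal.one_ne_top hp).2 hp1
  obtain ⟨C, hC, hle⟩ := exists_abs_sub_rpow_le hr hε
  refine ⟨C, hC, fun f g => ?_⟩
  have hf := Lp_integrable_rpow hp0 hp f
  have hg := Lp_integrable_rpow hp0 hp g
  have hm := Lp_integrable_rpow hp0 hp ((2⁻¹ : ℝ) • (f + g))
  have hsum : Integrable (fun x => |f x| ^ p.toReal + |g x| ^ p.toReal) μ := hf.add hg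
  have hhalf : Integrable (fun x => (|f x| ^ p.toReal + |g x| ^ p.toReal) / 2) μ :=
    hsum.div_const 2
  simp only [Lp_norm_rpow_eq_integral hp0 hp]
  rw [← integral_add hf hg, ← integral_const_mul, ← integral_div,
    ← integral_sub hhalf hm, ← integral_const_mul, ← integral_add]
  · refine integral_mono_ae (Lp_integrable_rpow hp0 hp (f - g)) ?_ ?_
    · exact (hsum.const_mul ε).add ((hhalf.sub hm).const_mul C)
    · filter_upwards [Lp.coeFn_sub f g, Lp.coeFn_smul (2⁻¹ : ℝ) (f + g), Lp.coeFn_add f g]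
        with x h1 h2 h3
      have h4 : (2⁻¹ : ℝ) * (f x + g x) = (f x + g x) / 2 := by ring
      simp only [h1, h2, h3, Pi.sub_apply, Pi.smul_apply, Pi.add_apply, smul_eq_mul, h4]
      exact hle (f x) (g x)
  · exact hsum.const_mul ε
  · exact (hhalf.sub hm).const_mul C

/-- **Clarkson's theorem**: `L^p` is uniformly convex for `1 < p < ∞`. -/
theorem uniformConvexSpace_Lp [Fact (1 ≤ p)] (hp1 : 1 < p) (hp : p ≠ ⊤) :
    UniformConvexSpace (Lp ℝ p μ) := by
  refine ⟨fun e he => ?_⟩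
  have hr : 0 < p.toReal := ENNReal.toReal_pos (zero_lt_one.trans hp1).ne' hp
  set r := p.toReal
  obtain ⟨C, hC, hle⟩ := Lp_exists_norm_sub_rpow_le (μ := μ) hp1 hp
    (by positivity : 0 < e ^ r / 4)
  -- For unit vectors at distance at least `e`, the midpoint has norm at most `(1 - e^r/(2C))^(1/r)`.
  set θ := max (1 - e ^ r / (2 * C)) 0 with hθ
  have hθ0 : 0 ≤ θ := le_max_right _ _
  have hθ1 : θ < 1 := max_lt (by linarith [show 0 < e ^ r / (2 * C) by positivity]) one_pos
  have hρ : θ ^ r⁻¹ < 1 := Real.rpow_lt_one hθ0 hθ1 (by positivity)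
  refine ⟨2 * (1 - θ ^ r⁻¹), by linarith, fun f hf g hg hfg => ?_⟩
  have key := hle f g
  rw [hf, hg, Real.one_rpow] at key
  have h1 : e ^ r ≤ ‖f - g‖ ^ r := by gcongr
  have h2 : ‖(2⁻¹ : ℝ) • (f + g)‖ ^ r ≤ θ := by
    refine le_trans ?_ (le_max_left _ _)
    have h3 : e ^ r / 2 ≤ C * (1 - ‖(2⁻¹ : ℝ) • (f + g)‖ ^ r) := by linarith
    have h4 : e ^ r / (2 * C) ≤ 1 - ‖(2⁻¹ : ℝ) • (f + g)‖ ^ r := by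
      rw [← div_div, div_le_iff₀ hC]
      linarith
    linarith
  have h5 : ‖(2⁻¹ : ℝ) • (f + g)‖ ≤ θ ^ r⁻¹ := by
    rw [← Real.rpow_rpow_inv (norm_nonneg ((2⁻¹ : ℝ) • (f + g))) hr.ne']
    gcongr
  rw [norm_smul, Real.norm_of_nonneg (by norm_num)] at h5
  linarith

theorem isReflexiveSpace_Lp [Fact (1 ≤ p)] (hp1 : 1 < p) (hp : p ≠ ⊤) :
    IsReflexiveSpace (Lp ℝ p μ) :=
  have := uniformConvexSpace_Lp (μ := μ) hp1 hp
  isReflexiveSpace_of_uniformConvexSpace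

end UniformConvexity

/-! ### Reflexivity of the Sobolev spaces and of the solution space -/

section SobolevReflexive

variable {n : ℕ} (D : Opens (Eucl n)) (p : ℝ≥0∞) [Fact (1 ≤ p)]

/-- Pairing with a fixed test function is continuous on `L^p(D)`, by Hölder's inequality. -/
theorem LpOn.continuous_toDistribution_apply (φ : 𝓓(D, ℝ)) :
    Continuous fun f : LpOn D p => LpOn.toDistribution D p f φ := by
  have : ENNReal.HolderConjugate p.conjExponent p :=
    (ENNReal.HolderConjugate.conjExponent Fact.out).symm
  have heq : (fun f : LpOn D p => LpOn.toDistribution D p f φ) =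
      (ContinuousLinearMap.mul ℝ ℝ).lpPairing (volume.restrict (D : Set (Eucl n)))
        p.conjExponent p (testToLp D p.conjExponent φ) := by
    funext f
    rw [LpOn.toDistribution_apply, ContinuousLinearMap.lpPairing_eq_integral]
    refine integral_congr_ae ?_
    filter_upwards [(testFunction_memLp p.conjExponent φ).coeFn_toLp] with x hx
    change φ x * f x = ((testFunction_memLp p.conjExponent φ).toLp φ : Eucl n → ℝ) x * f x
    rw [hx]
  rw [heq]
  exact ContinuousLinearMap.continuous _

/-- `∂^α` on distributions is the transpose of an operator on test functions (namely of
`(-1)^{|α|} ∂^α`), so that testing `∂^α T` amounts to testing `T`. -/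
theorem exists_partialD_apply_eq (α : Fin n → ℕ) (φ : 𝓓(D, ℝ)) :
    ∃ ψ : 𝓓(D, ℝ), ∀ T : 𝓓'(D, ℝ), partialD 𝓓'(D, ℝ) α T φ = T ψ := by
  have hpow : ∀ (w : Eucl n) (j : ℕ) (φ : 𝓓(D, ℝ)), ∃ ψ : 𝓓(D, ℝ), ∀ T : 𝓓'(D, ℝ),
      (lineDerivOpCLM ℝ 𝓓'(D, ℝ) w ^ j) T φ = T ψ := by
    intro w j
    induction j with
    | zero => exact fun φ => ⟨φ, fun T => rfl⟩
    | succ j ih =>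
      intro φ
      obtain ⟨ψ, hψ⟩ := ih (-∂_{w} φ)
      refine ⟨ψ, fun T => ?_⟩
      rw [pow_succ', mul_apply_eq_comp, lineDerivOpCLM_apply,
        Distribution.lineDerivOp_apply_apply, hψ]
  have hlist : ∀ (l : List (Fin n)) (φ : 𝓓(D, ℝ)), ∃ ψ : 𝓓(D, ℝ), ∀ T : 𝓓'(D, ℝ),
      (l.map fun i => lineDerivOpCLM ℝ 𝓓'(D, ℝ)
        (EuclideanSpace.single i (1 : ℝ) : Eucl n) ^ α i).prod T φ = T ψ := by
    intro l
    induction l with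
    | nil => exact fun φ => ⟨φ, fun T => rfl⟩
    | cons i l ih =>
      intro φ
      obtain ⟨χ, hχ⟩ := hpow (EuclideanSpace.single i (1 : ℝ)) (α i) φ
      obtain ⟨ψ, hψ⟩ := ih χ
      refine ⟨ψ, fun T => ?_⟩
      rw [List.map_cons, List.prod_cons, mul_apply_eq_comp, hχ, hψ]
  simpa only [partialD, List.ofFn_eq_map] using hlist (List.finRange n) φ

theorem SobolevNat.isClosed (j : ℕ) :
    IsClosed (SobolevNat D p j : Set (PiLp p fun _ : MultiIndex n j => LpOn D p)) := by
  have heq : (SobolevNat D p j : Set (PiLp p fun _ : MultiIndex n j => LpOn D p)) =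
      ⋂ (α : MultiIndex n j) (φ : 𝓓(D, ℝ)), {g | LpOn.toDistribution D p (g α) φ =
        partialD 𝓓'(D, ℝ) α.exps (LpOn.toDistribution D p (g MultiIndex.zero)) φ} := by
    ext g
    simp only [Set.mem_iInter]
    exact forall_congr' fun α => ⟨fun h φ => DFunLike.congr_fun h φ, fun h => DFunLike.ext _ _ h⟩
  rw [heq]
  refine isClosed_iInter fun α => isClosed_iInter fun φ => ?_
  obtain ⟨ψ, hψ⟩ := exists_partialD_apply_eq D α.exps φ
  refine isClosed_eq ?_ ?_
  · exact (LpOn.continuous_toDistribution_apply D p φ).comp (PiLp.continuous_apply p _ α)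
  · simp only [hψ]
    exact (LpOn.continuous_toDistribution_apply D p ψ).comp
      (PiLp.continuous_apply p _ MultiIndex.zero)

variable {p}

theorem isReflexiveSpace_SobolevNat (hp1 : 1 < p) (hp : p ≠ ⊤) (j : ℕ) :
    IsReflexiveSpace (SobolevNat D p j) :=
  (IsReflexiveSpace.piLp p fun _ => isReflexiveSpace_Lp hp1 hp).submodule _
    (SobolevNat.isClosed D p j)

theorem isReflexiveSpace_SobolevZero (hp1 : 1 < p) (hp : p ≠ ⊤) (j : ℕ) :
    IsReflexiveSpace (SobolevZero D p j) :=
  (isReflexiveSpace_SobolevNat D hp1 hp j).submodule _ (Submodule.isClosed_topologicalClosure _)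

theorem isReflexiveSpace_Sobolev (hp1 : 1 < p) (hp : p ≠ ⊤) (s : ℤ) :
    IsReflexiveSpace (Sobolev D p s) := by
  have hconj : ENNReal.HolderConjugate p p.conjExponent :=
    ENNReal.HolderConjugate.conjExponent Fact.out
  match s with
  | Int.ofNat j => exact isReflexiveSpace_SobolevNat D hp1 hp j
  | Int.negSucc j =>
    refine (isReflexiveSpace_SobolevZero D ?_ ?_ (j + 1)).strongDual
    · exact (ENNReal.HolderConjugate.lt_top_iff_one_lt p p.conjExponent).1 hp.lt_top
    · exact ((ENNReal.HolderConjugate.lt_top_iff_one_lt p.conjExponent p).2 hp1).ne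

variable (p)

theorem Sobolev.continuous_toDistribution_apply (s : ℤ) (φ : 𝓓(D, ℝ)) :
    Continuous fun u : Sobolev D p s => Sobolev.toDistribution D p s u φ := by
  match s with
  | Int.ofNat j =>
    exact (LpOn.continuous_toDistribution_apply D p φ).comp
      ((PiLp.continuous_apply p _ MultiIndex.zero).comp continuous_subtype_val)
  | Int.negSucc j =>
    exact (ContinuousLinearMap.apply ℝ ℝ
      (testToSobolevZero D p.conjExponent (j + 1) φ)).continuous

theorem sobolevSolutions_isClosed {k m : ℕ} {X : Opens (Eucl n)} (A : DiffOp n k m X)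
    {D : Opens (Eucl n)} (hD : D ≤ X) (s : ℤ) :
    IsClosed (A.sobolevSolutions hD s p : Set (PiLp p fun _ : Fin k => Sobolev D p s)) := by
  have heq : (A.sobolevSolutions hD s p : Set (PiLp p fun _ : Fin k => Sobolev D p s)) =
      ⋂ φ : Fin k → 𝓓(D, ℝ), {u | ∑ j, Sobolev.toDistribution D p s (u j)
        (A.adjointOnTest hD φ j) = 0} := by
    ext u
    simp only [Set.mem_iInter]
    rfl
  rw [heq]
  refine isClosed_iInter fun φ => isClosed_eq ?_ continuous_const
  exact continuous_finsetSum _ fun j _ =>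
    (Sobolev.continuous_toDistribution_apply D p s _).comp (PiLp.continuous_apply p _ j)

theorem isReflexiveSpace_sobolevSolutions {k m : ℕ} {X : Opens (Eucl n)} (A : DiffOp n k m X)
    {D : Opens (Eucl n)} (hD : D ≤ X) (s : ℤ) (hp1 : 1 < p) (hp : p ≠ ⊤) :
    IsReflexiveSpace (A.sobolevSolutions hD s p) :=
  (IsReflexiveSpace.piLp p fun _ => isReflexiveSpace_Sobolev D hp1 hp s).submodule _
    (sobolevSolutions_isClosed p A hD s)

end SobolevReflexive

/-! ### The regularized functionals -/

section RegularizedFunctional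

variable {k : ℕ} {q : ℝ≥0∞} {t : ℝ} (h : BddSeq k) (N : ℕ)

theorem dataFit_nonneg [Fact (1 ≤ q)] (g : Fin N × Fin k → ℝ) : 0 ≤ dataFit q t h N g := by
  unfold dataFit
  split_ifs <;> positivity

theorem dataFit_proj [Fact (1 ≤ q)] (ht : 1 ≤ t) : dataFit q t h N (proj N h) = 0 := by
  have ht0 : t ≠ 0 := by linarith
  unfold dataFit
  rw [sub_self, WithLp.toLp_zero, norm_zero, Real.zero_rpow ht0, mul_zero, ite_self]

theorem continuous_dataFit [Fact (1 ≤ q)] (ht : 1 ≤ t) : Continuous (dataFit q t h N) := by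
  have hnorm : Continuous fun g : Fin N × Fin k → ℝ => ‖WithLp.toLp q (g - proj N h)‖ :=
    ((PiLp.continuous_toLp q _).comp (continuous_id.sub continuous_const)).norm
  unfold dataFit
  split_ifs
  · exact hnorm
  · exact (hnorm.rpow_const fun _ => Or.inr (by linarith)).const_mul _

variable (q t) in
/-- The data fit controls the deviation of each single entry, uniformly in `N`. -/
theorem exists_abs_sub_proj_le_dataFit [Fact (1 ≤ q)] (ht : 1 ≤ t) (h : BddSeq k) :
    ∃ κ : ℝ → ℝ, Tendsto κ (𝓝 0) (𝓝 0) ∧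
      ∀ (N : ℕ) (g : Fin N × Fin k → ℝ) (i : Fin N × Fin k),
        |g i - proj N h i| ≤ κ (dataFit q t h N g) := by
  have hcoord : ∀ (N : ℕ) (g : Fin N × Fin k → ℝ) (i : Fin N × Fin k),
      |g i - proj N h i| ≤ ‖WithLp.toLp q (g - proj N h)‖ := fun N g i =>
    PiLp.norm_apply_le (WithLp.toLp q (g - proj N h)) i
  by_cases hq : q = ⊤
  · refine ⟨fun x => x, tendsto_id, fun N g i => ?_⟩
    simpa only [dataFit, if_pos hq] using hcoord N g i
  · have ht0 : 0 < t := by linarith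
    have hq0 : 0 < q.toReal :=
      ENNReal.toReal_pos (zero_lt_one.trans_le (Fact.out : 1 ≤ q)).ne' hq
    refine ⟨fun x => (q.toReal * x) ^ t⁻¹, ?_, fun N g i => ?_⟩
    · have hc : Continuous fun x : ℝ => (q.toReal * x) ^ t⁻¹ :=
        (continuous_const.mul continuous_id).rpow_const fun _ => Or.inr (by positivity)
      have := hc.tendsto 0
      rwa [mul_zero, Real.zero_rpow (inv_ne_zero ht0.ne')] at this
    · refine (hcoord N g i).trans_eq ?_
      simp only [dataFit, if_neg hq]
      rw [← mul_assoc, mul_one_div_cancel hq0.ne', one_mul,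
        Real.rpow_rpow_inv (norm_nonneg _) ht0.ne']

variable {S : Type*} [NormedAddCommGroup S] [NormedSpace ℝ S] {h N}

theorem proj_dataMapInfty (v : ℕ × Fin k → StrongDual ℝ S) (hv : ∀ i, ‖v i‖ ≤ 1) (w : S) :
    proj N (dataMapInfty v hv w) = dataMap v N w := rfl

theorem dataMapInfty_eq_iff (v : ℕ × Fin k → StrongDual ℝ S) (hv : ∀ i, ‖v i‖ ≤ 1) (w : S) :
    dataMapInfty v hv w = h ↔ ∀ i, v i w = h i :=
  ⟨fun hw i => by rw [← hw]; rfl, fun hw => by ext i; exact hw i⟩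

/-- The direct method: a minimizing sequence is bounded because `b > 0`, so it converges weakly
along an ultrafilter. The data are finitely many functionals, hence converge, and the norm does
not increase in the limit. -/
theorem IsReflexiveSpace.exists_isMinimizer_regularized (hS : IsReflexiveSpace S)
    (v : ℕ × Fin k → StrongDual ℝ S) {F : (Fin N × Fin k → ℝ) → ℝ} (hF : Continuous F)
    (hF0 : ∀ g, 0 ≤ F g) {b : ℝ} (hb : 0 < b) :
    ∃ u : S, IsMinimizer (regularized F (dataMap v N) b) u := by
  set Φ : S → ℝ := regularized F (dataMap v N) b with hΦ
  have hbound : ∀ u, b * ‖u‖ ≤ Φ u := fun u => le_add_of_nonneg_left (hF0 _)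
  have hbdd : BddBelow (Set.range Φ) := by
    refine ⟨0, ?_⟩
    rintro _ ⟨u, rfl⟩
    exact (by positivity : 0 ≤ b * ‖u‖).trans (hbound u)
  obtain ⟨y, -, hy, hmem⟩ := exists_seq_tendsto_sInf (Set.range_nonempty Φ) hbdd
  choose u hu using hmem
  set c := sInf (Set.range Φ)
  have hlim : Tendsto (fun j => Φ (u j)) (hyperfilter ℕ : Filter ℕ) (𝓝 c) := by
    simp only [hu]
    exact hy.mono_left Nat.hyperfilter_le_atTop
  obtain ⟨x, hx⟩ := hS.exists_tendsto (hyperfilter ℕ) u ((c + 1) / b) (by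
    filter_upwards [hlim.eventually_le_const (lt_add_one c)] with j hj
    rw [le_div_iff₀ hb, mul_comm]
    exact (hbound _).trans hj)
  refine ⟨x, fun w => le_trans ?_ (csInf_le hbdd ⟨w, rfl⟩)⟩
  obtain ⟨f, hf, hfx⟩ := exists_dual_vector'' ℝ x
  have hdata : Tendsto (fun j => dataMap v N (u j)) (hyperfilter ℕ : Filter ℕ)
      (𝓝 (dataMap v N x)) :=
    tendsto_pi_nhds.2 fun i => hx (v ((i.1 : ℕ), i.2))
  have hlow : Tendsto (fun j => F (dataMap v N (u j)) + b * f (u j)) (hyperfilter ℕ : Filter ℕ)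
      (𝓝 (F (dataMap v N x) + b * f x)) :=
    ((hF.tendsto _).comp hdata).add ((hx f).const_mul b)
  have hΦx : Φ x = F (dataMap v N x) + b * f x := by
    rw [hfx]
    rfl
  rw [hΦx]
  refine le_of_tendsto_of_tendsto' hlow hlim fun j => ?_
  have hfu : f (u j) ≤ 1 * ‖u j‖ := (le_abs_self _).trans (f.le_of_opNorm_le hf _)
  rw [one_mul] at hfu
  exact add_le_add_right (mul_le_mul_of_nonneg_left hfu hb.le) _

/-- Functionals with dense span separate points. -/
theorem eq_of_forall_eq_of_dense_span {ι : Type*} {v : ι → StrongDual ℝ S}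
    (hv : Dense (Submodule.span ℝ (Set.range v) : Set (StrongDual ℝ S))) {w w' : S}
    (hw : ∀ i, v i w' = v i w) : w' = w := by
  refine (SeparatingDual.eq_iff_forall_dual_eq (R := ℝ)).2 fun f => ?_
  have hclosed : IsClosed {f : StrongDual ℝ S | f w' = f w} :=
    isClosed_eq (ContinuousLinearMap.apply ℝ ℝ w').continuous
      (ContinuousLinearMap.apply ℝ ℝ w).continuous
  refine closure_minimal (fun f hf => ?_) hclosed (hv f)
  induction hf using Submodule.span_induction with
  | mem f hf =>
    obtain ⟨i, rfl⟩ := hf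
    exact hw i
  | zero => rfl
  | add f g _ _ hf hg => exact congrArg₂ (· + ·) hf hg
  | smul c f _ hf => exact congrArg (c • ·) hf

/-- A bounded sequence converges weakly if it converges when tested against a family of
functionals with dense span. -/
theorem tendsto_toWeakSpace_of_dense_span {ι : Type*} {v : ι → StrongDual ℝ S}
    (hv : Dense (Submodule.span ℝ (Set.range v) : Set (StrongDual ℝ S))) {u : ℕ → S} {w : S}
    {C : ℝ} (hC : ∀ᶠ j in atTop, ‖u j‖ ≤ C)
    (hu : ∀ i, Tendsto (fun j => v i (u j)) atTop (𝓝 (v i w))) :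
    Tendsto (fun j => toWeakSpace ℝ S (u j)) atTop (𝓝 (toWeakSpace ℝ S w)) := by
  have hspan : ∀ f ∈ Submodule.span ℝ (Set.range v),
      Tendsto (fun j => f (u j)) atTop (𝓝 (f w)) := by
    intro f hf
    induction hf using Submodule.span_induction with
    | mem f hf =>
      obtain ⟨i, rfl⟩ := hf
      exact hu i
    | zero => exact tendsto_const_nhds
    | add f g _ _ hf hg => exact hf.add hg
    | smul c f _ hf => exact hf.const_smul c
  have hall : ∀ f : StrongDual ℝ S, Tendsto (fun j => f (u j)) atTop (𝓝 (f w)) := by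
    intro f
    refine Metric.tendsto_nhds.2 fun ε hε => ?_
    set R := max C ‖w‖ + 1
    have hR : 0 < R := by linarith [le_max_right C ‖w‖, norm_nonneg w]
    obtain ⟨g, hg, hfg⟩ := Metric.mem_closure_iff.1 (hv f) (ε / (3 * R)) (by positivity)
    rw [dist_eq_norm] at hfg
    have hclose : ∀ x : S, ‖x‖ ≤ R → |f x - g x| ≤ ε / 3 := fun x hx => by
      have h1 : |(f - g) x| ≤ ε / (3 * R) * R := (f - g).le_of_opNorm_le_of_le hfg.le hx
      have h2 : ε / (3 * R) * R = ε / 3 := by field_simp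
      rwa [h2] at h1
    filter_upwards [hC, Metric.tendsto_nhds.1 (hspan g hg) (ε / 3) (by positivity)] with j hj hgj
    rw [Real.dist_eq] at hgj ⊢
    have h1 := hclose (u j) (hj.trans (by linarith [le_max_left C ‖w‖]))
    have h2 := hclose w (by linarith [le_max_right C ‖w‖])
    rw [abs_le] at h1 h2
    rw [abs_lt] at hgj ⊢
    constructor <;> linarith [h1.1, h1.2, h2.1, h2.2, hgj.1, hgj.2]
  have hind : IsInducing fun (x : WeakSpace ℝ S) (f : StrongDual ℝ S) =>
      (topDualPairing ℝ S).flip x f := ⟨rfl⟩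
  exact hind.tendsto_nhds_iff.2 (tendsto_pi_nhds.2 hall)

/-- If the regularized functionals are `O(b_N)` along a sequence, then the sequence is bounded and
its data converge to the prescribed ones. -/
theorem norm_le_and_tendsto_of_regularized_le [Fact (1 ≤ q)] (ht : 1 ≤ t)
    {v : ℕ × Fin k → StrongDual ℝ S} {b : ℕ → ℝ} (hb : ∀ N, 1 ≤ N → 0 < b N)
    (hb0 : Tendsto b atTop (𝓝 0)) {u : ℕ → S} {C : ℝ}
    (hu : ∀ N, 1 ≤ N → regularized (dataFit q t h N) (dataMap v N) (b N) (u N) ≤ C * b N) :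
    (∀ N, 1 ≤ N → ‖u N‖ ≤ C) ∧ ∀ i, Tendsto (fun N => v i (u N)) atTop (𝓝 (h i)) := by
  constructor
  · intro N hN
    refine le_of_mul_le_mul_left ?_ (hb N hN)
    rw [mul_comm (b N) C]
    exact (le_add_of_nonneg_left (dataFit_nonneg h N _)).trans (hu N hN)
  · intro i
    obtain ⟨κ, hκ, hle⟩ := exists_abs_sub_proj_le_dataFit q t ht h
    have hfit : Tendsto (fun N => dataFit q t h N (dataMap v N (u N))) atTop (𝓝 0) := by
      have hCb : Tendsto (fun N => C * b N) atTop (𝓝 0) := by simpa using hb0.const_mul C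
      refine tendsto_of_tendsto_of_tendsto_of_le_of_le' tendsto_const_nhds hCb
        (Eventually.of_forall fun N => dataFit_nonneg h N _) ?_
      filter_upwards [eventually_ge_atTop 1] with N hN
      have := hb N hN
      exact (le_add_of_nonneg_right (by positivity)).trans (hu N hN)
    refine tendsto_iff_dist_tendsto_zero.2 (squeeze_zero' (Eventually.of_forall fun N =>
      dist_nonneg) ?_ (hκ.comp hfit))
    filter_upwards [eventually_gt_atTop i.1] with N hN
    exact hle N (dataMap v N (u N)) (⟨i.1, hN⟩, i.2)

end RegularizedFunctional

end EllipticSol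

open EllipticSol
theorem mainTheorem4 (n k m : ℕ) (hn : 2 ≤ n) (hk : 1 ≤ k) (hm : 1 ≤ m)
    (X : Opens (Eucl n)) (hX : IsConnected (X : Set (Eucl n)))
    (A : DiffOp n k m X) (hA : A.IsElliptic) (hUCP : A.UCP) (hUCP' : A.AdjointUCP)
    (D : Opens (Eucl n)) (hD : D ≤ X) (hDconn : IsConnected (D : Set (Eucl n)))
    (hDcpt : IsCompact (closure (D : Set (Eucl n))))
    (hDX : closure (D : Set (Eucl n)) ⊆ (X : Set (Eucl n)))
    (hDsmooth : HasSmoothBoundary (D : Set (Eucl n)))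
    (hcompl : NoCompactComponents ((X : Set (Eucl n)) \ (D : Set (Eucl n))))
    (s : ℤ) (p : ℝ≥0∞) [Fact (1 ≤ p)] (hp1 : 1 < p) (hp : p < ⊤)
    (v : ℕ × Fin k → StrongDual ℝ (A.sobolevSolutions hD s p))
    (hvind : LinearIndependent ℝ v)
    (hvdense : Dense (Submodule.span ℝ (Set.range v) :
      Set (StrongDual ℝ (A.sobolevSolutions hD s p))))
    (hvbdd : ∀ i, ‖v i‖ ≤ 1)
    (h : BddSeq k) (q : ℝ≥0∞) (hq : 1 ≤ q) (t : ℝ) (ht : 1 ≤ t)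
    (b : ℕ → ℝ) (hb : ∀ N, 1 ≤ N → 0 < b N) (hb0 : Tendsto b atTop (𝓝 0)) :
    (∀ N, 1 ≤ N → ∃ u : A.sobolevSolutions hD s p,
      IsMinimizer (regularized (dataFit q t h N) (dataMap v N) (b N)) u) ∧
    ∀ u : ℕ → A.sobolevSolutions hD s p,
      (∀ N, 1 ≤ N →
        IsMinimizer (regularized (dataFit q t h N) (dataMap v N) (b N)) (u N)) →
      ((∃ w, dataMapInfty v hvbdd w = h) ↔
        ∃ C₀ : ℝ, 0 < C₀ ∧ ∀ N, 1 ≤ N →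
          regularized (dataFit q t h N) (dataMap v N) (b N) (u N) ≤ C₀ * b N) ∧
      ∀ w, dataMapInfty v hvbdd w = h →
        (∀ w', dataMapInfty v hvbdd w' = h → w' = w) ∧
        Tendsto (fun N => toWeakSpace ℝ (A.sobolevSolutions hD s p) (u N)) atTop
          (𝓝 (toWeakSpace ℝ (A.sobolevSolutions hD s p) w)) := by
  have : Fact (1 ≤ q) := ⟨hq⟩
  have hS : IsReflexiveSpace (A.sobolevSolutions hD s p) :=
    isReflexiveSpace_sobolevSolutions p A hD s hp1 hp.ne
  refine ⟨fun N hN => hS.exists_isMinimizer_regularized v (continuous_dataFit h N ht)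
    (dataFit_nonneg h N) (hb N hN), fun u hu => ?_⟩
  -- Comparing the minimizer with an exact solution `w`, whose data fit vanishes.
  have hle : ∀ w, dataMapInfty v hvbdd w = h → ∀ N, 1 ≤ N →
      regularized (dataFit q t h N) (dataMap v N) (b N) (u N) ≤ ‖w‖ * b N := by
    intro w hw N hN
    refine (hu N hN w).trans_eq ?_
    rw [regularized, ← proj_dataMapInfty v hvbdd w, hw, dataFit_proj h N ht, zero_add, mul_comm]
  refine ⟨⟨?_, ?_⟩, fun w hw => ⟨fun w' hw' => ?_, ?_⟩⟩
  · rintro ⟨w, hw⟩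
    refine ⟨‖w‖ + 1, by positivity, fun N hN => (hle w hw N hN).trans ?_⟩
    exact mul_le_mul_of_nonneg_right (by linarith) (hb N hN).le
  · rintro ⟨C₀, -, hC₀⟩
    obtain ⟨hbdd, hlim⟩ := norm_le_and_tendsto_of_regularized_le ht hb hb0 hC₀
    obtain ⟨w, hw⟩ := hS.exists_tendsto (hyperfilter ℕ) u C₀
      (Nat.hyperfilter_le_atTop ((eventually_ge_atTop 1).mono hbdd))
    exact ⟨w, (dataMapInfty_eq_iff v hvbdd w).2 fun i =>
      tendsto_nhds_unique (hw (v i)) ((hlim i).mono_left Nat.hyperfilter_le_atTop)⟩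
  · refine eq_of_forall_eq_of_dense_span hvdense fun i => ?_
    rw [(dataMapInfty_eq_iff v hvbdd w').1 hw' i, (dataMapInfty_eq_iff v hvbdd w).1 hw i]
  · obtain ⟨hbdd, hlim⟩ := norm_le_and_tendsto_of_regularized_le ht hb hb0 (hle w hw)
    refine tendsto_toWeakSpace_of_dense_span hvdense
      ((eventually_ge_atTop 1).mono hbdd) fun i => ?_
    rw [(dataMapInfty_eq_iff v hvbdd w).1 hw i]
    exact hlim i
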